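/- \textbf{Setting.} Let $\mathbb F$ be a finite field. An exact-repair cooperative regenerating code with parameters $(n,k,d,t,\alpha,\beta,\beta')$ for files of size $\mathcal M$ encodes each file ${\bf f}\in\mathbb F^{\mathcal M}$ into node contents ${\bf x}_1,\dots,{\bf x}_n\in\mathbb F^{\alpha}$ such that (a) the contents of any $k$ nodes determine ${\bf f}$; (b) whenever a group of $t$ nodes fails, and each of the $t$ newcomers contacts any $d$ live nodes, the lost contents can be restored exactly as follows: each contacted live node sends the newcomer $\beta$ symbols that are a function of its own content, then each newcomer sends each other newcomer of the group $\beta'$ symbols that are a function of what it downloaded from live nodes, and each newcomer recovers its lost content from the $d\beta+(t-1)\beta'$ symbols it received. The code operates at the minimum bandwidth cooperative regenerating (MBCR) point if $$\alpha=d\beta+(t-1)\beta'=\frac{\mathcal M}{k}\,\frac{2d+t-1}{2d+t-k},\qquad \beta=\frac{\mathcal M}{k}\,\frac{2}{2d+t-k},\qquad \beta'=\frac{\mathcal M}{k}\,\frac{1}{2d+t-k};$$ for $\mathcal M=k(2d-k+t)$ this means $\beta'=1$, $\beta=2$, $\alpha=2d+t-1$. A secure file size $\mathcal M^s\in\mathbb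 N$ is achieved over $\mathbb F$ against an $(\ell_1,0)$ eavesdropper if there are such a code and a randomized encoding of a uniformly distributed secure file ${\bf f}^s\in\mathbb F^{\mathcal M^s}$ into a file ${\bf f}\in\mathbb F^{\mathcal M}$, where ${\bf f}$ determines ${\bf f}^s$, such that $I({\bf f}^s;({\bf x}_i)_{i\in\mathcal E})=0$ for every set $\mathcal E$ of $\ell_1$ nodes. The secrecy capacity is the largest achieved secure file size. \textbf{Proposition.} Let $1\le k\le d$, $t\ge 1$, $0\le\ell_1\le k$ and $n=d+t$. Then the secrecy capacity at the MBCR point for file size $\mathcal M=k(2d-k+t)$ against an $(\ell_1,0)$ eavesdropper is $$k(2d-k+t)-\ell_1(2d-\ell_1+t).$$ More precisely, over no finite field can a larger secure file size be achieved, and over every sufficiently large finite field (with a threshold depending only on $k,d,t,\ell_1$) this secure file size is achieved. -/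

import Mathlib

open scoped ENNReal

universe u

/-- An exact-repair cooperative regenerating code with parameters `(n, k, d, t, α, β, β')` over the
alphabet `F`, storing files of `M` symbols on `n` nodes with `α` symbols each. -/
structure CoopRegeneratingCode (F : Type*) (n k d t M α β β' : ℕ) where
  /-- `encode f i` is the content of node `i` when the file is `f`. -/
  encode : (Fin M → F) → Fin n → (Fin α → F)
  /-- The contents of any `k` nodes determine the file. -/
  reconstruct : ∀ K : Finset (Fin n), K.card = k →
    ∃ dec : (K → Fin α → F) → (Fin M → F), ∀ f, dec (fun j => encode f j) = f
  /-- Exact cooperative repair of any group `T` of `t` failed nodes, where the newcomer `i ∈ T`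
  contacts an arbitrary set `H i` of `d` live nodes.  First, each live node `j ∈ H i` sends to `i`
  the `β` symbols `down i j x_j` computed from its content `x_j`.  Then, each other newcomer
  `i' ∈ T` sends to `i` the `β'` symbols `coop i' i _` computed from what `i'` has downloaded from
  live nodes.  From all the symbols that it received, `i` regenerates the lost content. -/
  repair : ∀ T : Finset (Fin n), T.card = t →
    ∀ H : T → Finset (Fin n), (∀ i, (H i).card = d ∧ Disjoint (H i) T) →
    ∃ (down : (i : T) → H i → (Fin α → F) → (Fin β → F))
      (coop : (i' : T) → T → (H i' → Fin β → F) → (Fin β' → F))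
      (regen : (i : T) → (H i → Fin β → F) → ({i' : T // i' ≠ i} → Fin β' → F) → (Fin α → F)),
      ∀ (f : Fin M → F) (i : T),
        regen i (fun j => down i j (encode f j))
          (fun i' => coop i' i (fun j => down i' j (encode f j))) = encode f i

/-- The minimum bandwidth cooperative regenerating (MBCR) point for file size `M`. -/
structure IsMBCRPoint (k d t M α β β' : ℕ) : Prop where
  storage : (α : ℚ) = (M : ℚ) / k * ((2 * d + t - 1) / (2 * d + t - k))
  /-- The total repair bandwidth per newcomer equals its storage. -/
  bandwidth : (d : ℚ) * β + (t - 1) * β' = α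
  helper : (β : ℚ) = (M : ℚ) / k * (2 / (2 * d + t - k))
  cooperative : (β' : ℚ) = (M : ℚ) / k * (1 / (2 * d + t - k))

/-- Mutual information `I(A; B)` of a pair of discrete random variables with joint law `p`:
the Kullback-Leibler divergence of the joint law from the product of its marginals. -/
noncomputable def mutualInfo {A B : Type*} (p : PMF (A × B)) : ℝ≥0∞ :=
  letI : MeasurableSpace A := ⊤
  letI : MeasurableSpace B := ⊤
  InformationTheory.klDiv p.toMeasure
    ((p.map Prod.fst).toMeasure.prod (p.map Prod.snd).toMeasure)

/-- A randomized encoding of a secure file of `Ms` symbols into a file of `M` symbols, from which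
the secure file can be read off again. -/
structure SecrecyPrecoding (F : Type*) (Ms M : ℕ) where
  /-- The law of the stored file given the secure file. -/
  enc : (Fin Ms → F) → PMF (Fin M → F)
  dec : (Fin M → F) → (Fin Ms → F)
  dec_enc : ∀ u, ∀ f ∈ (enc u).support, dec f = u

/-- The joint law of the secure file, uniformly distributed, and of the observation `obs f` of the
stored file `f`. -/
noncomputable def SecrecyPrecoding.jointLaw {F : Type*} [Fintype F] [Nonempty F] {Ms M : ℕ}
    (P : SecrecyPrecoding F Ms M) {O : Type*} (obs : (Fin M → F) → O) :
    PMF ((Fin Ms → F) × O) :=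
  (PMF.uniformOfFintype (Fin Ms → F)).bind fun u => (P.enc u).map fun f => (u, obs f)

/-- Some code with the given parameters, preceded by some secrecy precoding, achieves a secure file
size of `Ms` symbols against an `(ℓ₁, 0)` eavesdropper: the contents of any `ℓ₁` nodes have zero
mutual information with the secure file. -/
def AchievesSecureFileSize (F : Type*) [Fintype F] [Nonempty F]
    (n k d t M α β β' ℓ₁ Ms : ℕ) : Prop :=
  ∃ (code : CoopRegeneratingCode F n k d t M α β β') (P : SecrecyPrecoding F Ms M),
    ∀ E : Finset (Fin n), E.card = ℓ₁ →
      mutualInfo (P.jointLaw fun f (i : E) => code.encode f i) = 0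

/-!
At the MBCR point with `M = k (2d - k + t)` the parameters are `α = 2d + t - 1`, `β = 2`, `β' = 1`
(`IsMBCRPoint.eq_of_file_size`).

**Converse.**  Repair node `s` in a group disjoint from nodes `0, …, s - 1`, with all these nodes
among its helpers.  Then its content is determined by theirs together with the
`2 (d - s) + (t - 1)` symbols coming from the other helpers and the other newcomers.  Summing over
`ℓ ≤ s < k`, the contents of the first `ℓ` nodes and `C = k (2d - k + t) - ℓ (2d - ℓ + t)` further
symbols determine the contents of the first `k` nodes, hence the file and the secret
(`CoopRegeneratingCode.exists_symbols_determining_nodes`).  Zero mutual information means that every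
secret is compatible with every observation that occurs (`exists_mem_support_obs_eq`).  Fixing one
observation, the `C` further symbols must tell all the secrets apart, so there are at most
`|F| ^ C` secrets.  No entropy computation is needed.

**Achievability.**  Let `n ≤ |F|` and choose distinct points `x_i` of `F`.  A file is a bivariate
polynomial `U(X, Y) = ∑ U_{ab} X^a Y^b` with `a < d`, `b < n` and `U_{ab} = 0` unless `a < k` or
`b < k`; node `i` stores the polynomials `U(x_i, Y)` and `U(X, x_i)`, as `n` and `d` values that
share the value at `(x_i, x_i)`.  A helper `j` sends `U(x_j, x_i)` and `U(x_i, x_j)` to newcomer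
`i`, which then knows `U(X, x_i)`, including the value `U(x_{i'}, x_i)` which it sends to any other
newcomer `i'`; after that `i` knows `U(x_i, Y)` at all the points (`StorageLayout.code`).

Reading off the file from `k` nodes is interpolation (`eq_of_evalMatrix_eq`).  The same lemma with
`ℓ` in place of `k` says that polynomials supported on `a < ℓ` or `b < ℓ` are determined by the
contents of `ℓ` nodes `E`.  There are as many such coefficients as there are values that `E` sees
independently, so every observation by `E` is the observation of exactly one such polynomial
(`exists_hook_eq_evalMatrix`).  Filling these coefficients with uniform randomness and all others
with the secret makes the law of the observation independent of the secret.
-/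

/-! ### Zero mutual information -/

theorem mutualInfo_eq_zero_iff {A B : Type*} [Finite A] [Finite B] (p : PMF (A × B)) :
    mutualInfo p = 0 ↔ ∀ a b, p (a, b) = p.map Prod.fst a * p.map Prod.snd b := by
  let _ : MeasurableSpace A := ⊤
  let _ : MeasurableSpace B := ⊤
  have hprod (a : A) (b : B) :
      ((p.map Prod.fst).toMeasure.prod (p.map Prod.snd).toMeasure) {(a, b)} =
        p.map Prod.fst a * p.map Prod.snd b := by
    rw [← Set.singleton_prod_singleton, MeasureTheory.Measure.prod_prod,
      PMF.toMeasure_apply_singleton _ _ (MeasurableSet.singleton a),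
      PMF.toMeasure_apply_singleton _ _ (MeasurableSet.singleton b)]
  have hp (x : A × B) : p.toMeasure {x} = p x :=
    PMF.toMeasure_apply_singleton _ _ (MeasurableSet.singleton x)
  unfold mutualInfo
  rw [InformationTheory.klDiv_eq_zero_iff]
  constructor
  · intro h a b
    rw [← hprod, ← h, hp]
  · intro h
    refine MeasureTheory.Measure.ext_of_singleton fun x => ?_
    rw [hp]
    exact (h x.1 x.2).trans (hprod x.1 x.2).symm

theorem mem_support_jointLaw {F : Type*} [Fintype F] [Nonempty F] {Ms M : ℕ}
    (P : SecrecyPrecoding F Ms M) {O : Type*} (obs : (Fin M → F) → O) (u : Fin Ms → F) (o : O) :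
    (u, o) ∈ (P.jointLaw obs).support ↔ ∃ f ∈ (P.enc u).support, obs f = o := by
  simp only [SecrecyPrecoding.jointLaw, PMF.mem_support_bind_iff, PMF.mem_support_map_iff,
    PMF.mem_support_uniformOfFintype, true_and, Prod.mk.injEq]
  aesop

/-- If the observation is independent of the secret, then some observation is compatible with every
secret. -/
theorem exists_mem_support_obs_eq {F : Type*} [Fintype F] [Nonempty F] {Ms M : ℕ}
    (P : SecrecyPrecoding F Ms M) {O : Type*} [Finite O] (obs : (Fin M → F) → O)
    (h : mutualInfo (P.jointLaw obs) = 0) :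
    ∃ o, ∀ u, ∃ f ∈ (P.enc u).support, obs f = o := by
  obtain ⟨u₀⟩ : Nonempty (Fin Ms → F) := inferInstance
  obtain ⟨f₀, hf₀⟩ := (P.enc u₀).support_nonempty
  refine ⟨obs f₀, fun u => ?_⟩
  rw [← mem_support_jointLaw, PMF.mem_support_iff, (mutualInfo_eq_zero_iff _).1 h]
  obtain ⟨f, hf⟩ := (P.enc u).support_nonempty
  refine mul_ne_zero ?_ ?_
  · rw [← PMF.mem_support_iff, PMF.mem_support_map_iff]
    exact ⟨(u, obs f), (mem_support_jointLaw ..).2 ⟨f, hf, rfl⟩, rfl⟩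
  · rw [← PMF.mem_support_iff, PMF.mem_support_map_iff]
    exact ⟨(u₀, obs f₀), (mem_support_jointLaw ..).2 ⟨f₀, hf₀, rfl⟩, rfl⟩

/-- If the conditional law of the observation does not depend on the secret, nothing leaks. -/
theorem mutualInfo_jointLaw_eq_zero {F : Type*} [Fintype F] [Nonempty F] {Ms M : ℕ}
    (P : SecrecyPrecoding F Ms M) {O : Type*} [Finite O] (obs : (Fin M → F) → O) (κ : PMF O)
    (h : ∀ u, (P.enc u).map obs = κ) : mutualInfo (P.jointLaw obs) = 0 := by
  classical
  have hfst : (P.jointLaw obs).map Prod.fst = PMF.uniformOfFintype (Fin Ms → F) := by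
    simp only [SecrecyPrecoding.jointLaw, PMF.map_bind, PMF.map_comp, Function.comp_def]
    exact (congrArg _ (funext fun u => PMF.map_const (P.enc u) u)).trans (PMF.bind_pure _)
  have hsnd : (P.jointLaw obs).map Prod.snd = κ := by
    simp [SecrecyPrecoding.jointLaw, PMF.map_bind, PMF.map_comp, Function.comp_def, h]
  rw [mutualInfo_eq_zero_iff]
  intro u o
  rw [hfst, hsnd, ← h u]
  have hu (v : Fin Ms → F) : ((P.enc v).map fun f => (v, obs f)) (u, o) =
      if v = u then (P.enc u).map obs o else 0 := by
    split_ifs with hv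
    · subst hv; simp [PMF.map_apply]
    · simp [PMF.map_apply, Ne.symm hv]
  simp only [SecrecyPrecoding.jointLaw, PMF.bind_apply, hu]
  rw [tsum_eq_single u (by intro v hv; simp [hv])]
  simp

theorem PMF.map_equiv_uniformOfFintype {A : Type*} [Fintype A] [Nonempty A] (e : A ≃ A) :
    (PMF.uniformOfFintype A).map e = PMF.uniformOfFintype A := by
  ext a
  rw [PMF.map_apply, tsum_eq_single (e.symm a)]
  · simp
  · intro b hb
    rw [if_neg]
    rintro rfl
    simp at hb

/-! ### The converse bound -/

theorem IsMBCRPoint.eq_of_file_size {k d t M α β β' : ℕ} (hk : 1 ≤ k) (hkd : k ≤ d) (ht : 1 ≤ t)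
    (hM : (M : ℤ) = k * (2 * d - k + t)) (h : IsMBCRPoint k d t M α β β') :
    α + 1 = 2 * d + t ∧ β = 2 ∧ β' = 1 := by
  have hk' : (k : ℚ) ≠ 0 := by positivity
  have hpos : (2 * d + t - k : ℚ) ≠ 0 := by
    have : (k : ℚ) ≤ d := by exact_mod_cast hkd
    have : (1 : ℚ) ≤ t := by exact_mod_cast ht
    have : (1 : ℚ) ≤ k := by exact_mod_cast hk
    linarith
  have hMk : (M : ℚ) / k = 2 * d + t - k := by
    have : (M : ℚ) = k * (2 * d - k + t) := by exact_mod_cast hM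
    rw [this]; field_simp; ring
  have h1 := h.storage
  have h2 := h.helper
  have h3 := h.cooperative
  rw [hMk, mul_div_cancel₀ _ hpos] at h1 h2 h3
  refine ⟨?_, by exact_mod_cast h2, by exact_mod_cast h3⟩
  have : (α : ℚ) + 1 = 2 * d + t := by linarith
  exact_mod_cast this

/-- The set `{0, …, s - 1}` of elements of `Fin n` below `s`. -/
def firstNodes (n s : ℕ) : Finset (Fin n) := Finset.univ.filter fun i => i.1 < s

theorem card_firstNodes {n s : ℕ} (h : s ≤ n) : (firstNodes n s).card = s := by
  simp [firstNodes, Fin.card_filter_val_lt, h]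

namespace CoopRegeneratingCode

variable {F : Type*} {n k d t M α β β' : ℕ}

/-- The cut-set bound for one node: repairing `i` in a group that avoids `S`, with all of `S` among
the helpers, costs only `(d - |S|) β + (t - 1) β'` symbols beyond the contents of `S`. -/
theorem exists_symbols_determining_node (c : CoopRegeneratingCode F n k d t M α β β')
    (hn : n = d + t) (S : Finset (Fin n)) (i : Fin n) (hi : i ∉ S) (hS : S.card < d)
    (ht : 1 ≤ t) :
    ∃ (I : Type) (_ : Fintype I) (G : (Fin M → F) → I → F),
      Fintype.card I = (d - S.card) * β + (t - 1) * β' ∧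
      ∀ f f', (∀ j ∈ S, c.encode f j = c.encode f' j) → G f = G f' →
        c.encode f i = c.encode f' i := by
  -- As `n = d + t`, all live nodes must serve as helpers, and it suffices to choose the group `T`.
  obtain ⟨T, hiT, hTS, hT⟩ : ∃ T : Finset (Fin n), {i} ⊆ T ∧ T ⊆ Sᶜ ∧ T.card = t := by
    refine Finset.exists_subsuperset_card_eq (by simpa using hi) (by simpa using ht) ?_
    rw [Finset.card_compl, Fintype.card_fin]; omega
  replace hiT : i ∈ T := by simpa using hiT
  have hH : Tᶜ.card = d := by rw [Finset.card_compl, Fintype.card_fin]; omega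
  have hSH : S ⊆ Tᶜ := Finset.subset_compl_comm.1 hTS
  obtain ⟨down, coop, regen, hrep⟩ :=
    c.repair T hT (fun _ => Tᶜ) (fun _ => ⟨hH, disjoint_compl_left⟩)
  let i₀ : T := ⟨i, hiT⟩
  refine ⟨((Tᶜ \ S : Finset (Fin n)) × Fin β) ⊕ ({i' : T // i' ≠ i₀} × Fin β'),
    inferInstance, fun f => Sum.elim
      (fun p => down i₀ ⟨p.1, (Finset.mem_sdiff.1 p.1.2).1⟩ (c.encode f p.1) p.2)
      (fun p => coop p.1 i₀ (fun j => down p.1 j (c.encode f j)) p.2), ?_, ?_⟩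
  · have h1 : (Tᶜ \ S).card = d - S.card := by
      rw [Finset.card_sdiff_of_subset hSH, hH]
    have h2 : Fintype.card {i' : T // i' ≠ i₀} = t - 1 := by
      simp [Fintype.card_subtype_compl, hT]
    rw [Fintype.card_sum, Fintype.card_prod, Fintype.card_prod, Fintype.card_coe, h1, h2,
      Fintype.card_fin, Fintype.card_fin]
  · intro f f' hff hG
    have hd : (fun j : (Tᶜ : Finset (Fin n)) => down i₀ j (c.encode f j)) =
        fun j => down i₀ j (c.encode f' j) := by
      funext j
      by_cases hj : j.1 ∈ S
      · rw [hff _ hj]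
      · funext b
        exact congrFun hG (Sum.inl (⟨j, Finset.mem_sdiff.2 ⟨j.2, hj⟩⟩, b))
    have hc : (fun i' : {i' : T // i' ≠ i₀} => coop i'.1 i₀ fun j => down i'.1 j (c.encode f j)) =
        fun i' : {i' : T // i' ≠ i₀} => coop i'.1 i₀ fun j => down i'.1 j (c.encode f' j) := by
      funext i' b
      exact congrFun hG (Sum.inr (i', b))
    rw [← hrep f i₀, ← hrep f' i₀, hd, hc]

/-- The single-node bounds summed over the nodes `l, …, l + m - 1`: the number of symbols is
`∑ s ∈ [l, l + m), (2 (d - s) + (t - 1))`. -/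
theorem exists_symbols_determining_nodes (c : CoopRegeneratingCode F n k d t M α 2 1)
    (hn : n = d + t) (ht : 1 ≤ t) {l : ℕ} (hld : l ≤ d) (m : ℕ) (hm : l + m ≤ d) :
    ∃ (I : Type) (_ : Fintype I) (G : (Fin M → F) → I → F),
      (Fintype.card I : ℤ) = m * (2 * d + t - 2 * l - m) ∧
      ∀ f f', (∀ j ∈ firstNodes n l, c.encode f j = c.encode f' j) → G f = G f' →
        ∀ j ∈ firstNodes n (l + m), c.encode f j = c.encode f' j := by
  induction m with
  | zero => exact ⟨Empty, inferInstance, fun _ => Empty.elim, by simp, fun f f' h _ => by simpa⟩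
  | succ m ih =>
    obtain ⟨I, _, G, hI, hG⟩ := ih (by omega)
    obtain ⟨J, _, G', hJ, hG'⟩ := c.exists_symbols_determining_node hn (firstNodes n (l + m))
      ⟨l + m, by omega⟩ (by simp [firstNodes]) (by rw [card_firstNodes (by omega)]; omega) ht
    refine ⟨I ⊕ J, inferInstance, fun f => Sum.elim (G f) (G' f), ?_, ?_⟩
    · rw [card_firstNodes (by omega)] at hJ
      obtain ⟨s, rfl⟩ : ∃ s, d = l + m + s := ⟨d - (l + m), by omega⟩
      obtain ⟨r, rfl⟩ : ∃ r, t = r + 1 := ⟨t - 1, by omega⟩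
      rw [Nat.add_sub_cancel_left, Nat.add_sub_cancel] at hJ
      rw [Fintype.card_sum, hJ]
      push_cast at hI ⊢
      rw [hI]; ring
    · intro f f' hff hGG j hj
      have h1 := hG f f' hff (funext fun a => congrFun hGG (Sum.inl a))
      have h2 := hG' f f' h1 (funext fun a => congrFun hGG (Sum.inr a))
      rcases Nat.lt_succ_iff_lt_or_eq.1 (show j.1 < (l + m) + 1 by
        simpa [firstNodes, add_assoc] using hj) with h | h
      · exact h1 j (by simpa [firstNodes] using h)
      · rwa [show j = ⟨l + m, by omega⟩ from Fin.ext h]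

end CoopRegeneratingCode

/-- The secrets inject into the symbols that, next to one fixed observation, determine the file. -/
theorem AchievesSecureFileSize.le {F : Type*} [Field F] [Fintype F] {n k d t l M α Ms C : ℕ}
    (hkd : k ≤ d) (ht : 1 ≤ t) (hl : l ≤ k) (hn : n = d + t)
    (hC : (C : ℤ) = k * (2 * d - k + t) - l * (2 * d - l + t))
    (h : AchievesSecureFileSize F n k d t M α 2 1 l Ms) : Ms ≤ C := by
  classical
  obtain ⟨c, P, hP⟩ := h
  obtain ⟨o, ho⟩ := exists_mem_support_obs_eq P _
    (hP (firstNodes n l)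
      (card_firstNodes (by omega)))
  choose f hf hfo using ho
  obtain ⟨I, _, G, hI, hG⟩ := c.exists_symbols_determining_nodes hn ht (l := l) (by omega)
    (k - l) (by omega)
  rw [Nat.add_sub_cancel' hl] at hG
  obtain ⟨dec, hdec⟩ := c.reconstruct (firstNodes n k)
    (card_firstNodes (by omega))
  have hinj : Function.Injective fun u => G (f u) := by
    intro u v huv
    have hE (j) (hj : j ∈ firstNodes n l) :
        c.encode (f u) j = c.encode (f v) j :=
      congrFun ((hfo u).trans (hfo v).symm) ⟨j, hj⟩
    have hK := hG _ _ hE huv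
    have hfuv : f u = f v := by
      rw [← hdec (f u), ← hdec (f v)]
      exact congrArg dec (funext fun j => hK j j.2)
    rw [← P.dec_enc u _ (hf u), hfuv, P.dec_enc v _ (hf v)]
  have hcard := Fintype.card_le_of_injective _ hinj
  have hIC : Fintype.card I = C := by
    zify
    rw [hI, hC, Nat.cast_sub hl]; ring
  rw [Fintype.card_fun, Fintype.card_fun, Fintype.card_fin, hIC] at hcard
  exact (Nat.pow_le_pow_iff_right Fintype.one_lt_card).1 hcard

/-! ### Hook-shaped index sets -/

/-- The positions in the rows `A`, together with those in the columns `B` that lie in the rows `D`.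
Such sets describe the coefficients of a file, the values stored by a node and the values seen by an
eavesdropper. -/
def hook {ι κ : Type*} [Fintype κ] [DecidableEq ι] [DecidableEq κ] (A D : Finset ι)
    (B : Finset κ) : Finset (ι × κ) :=
  A ×ˢ Finset.univ ∪ D ×ˢ B

section Hook

variable {ι κ : Type*} [Fintype κ] [DecidableEq ι] [DecidableEq κ] {A D : Finset ι}
  {B : Finset κ}

theorem mem_hook {p : ι × κ} : p ∈ hook A D B ↔ p.1 ∈ A ∨ p.1 ∈ D ∧ p.2 ∈ B := by
  simp [hook]

theorem card_hook (h : A ⊆ D) :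
    (hook A D B).card = A.card * Fintype.card κ + (D.card - A.card) * B.card := by
  have : hook A D B = A ×ˢ Finset.univ ∪ (D \ A) ×ˢ B := by
    ext p
    simp only [hook, Finset.mem_union, Finset.mem_product, Finset.mem_univ, Finset.mem_sdiff]
    tauto
  rw [this, Finset.card_union_of_disjoint, Finset.card_product, Finset.card_product,
    Finset.card_sdiff_of_subset h, Finset.card_univ]
  rw [Finset.disjoint_left]
  simp +contextual

end Hook

/-! ### Interpolation of bivariate polynomials -/

/-- Univariate interpolation: polynomials with coefficients `c` and `c'` that differ only in degrees
below `s` are equal if they agree at `s` points. -/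
theorem eq_of_sum_mul_pow_eq {F : Type*} [Field F] {n m : ℕ} {x : Fin n → F}
    (hx : Function.Injective x) {s : ℕ} {D : Finset (Fin n)} (hD : s ≤ D.card) {c c' : Fin m → F}
    (hc : ∀ a, s ≤ a.1 → c a = c' a)
    (h : ∀ i ∈ D, ∑ a, c a * x i ^ a.1 = ∑ a, c' a * x i ^ a.1) : c = c' := by
  classical
  let p : Polynomial F := ∑ a, Polynomial.monomial a.1 (c a - c' a)
  have hp : p.degree < s := by
    refine Polynomial.mem_degreeLT.1 (Submodule.sum_mem _ fun a _ => Polynomial.mem_degreeLT.2 ?_)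
    by_cases ha : s ≤ a.1
    · simp [hc a ha]
    · exact (Polynomial.degree_monomial_le _ _).trans_lt (by exact_mod_cast not_le.1 ha)
  have hp0 : p = 0 := by
    refine Polynomial.eq_zero_of_degree_lt_of_eval_finset_eq_zero (D.image x) ?_ ?_
    · rw [Finset.card_image_of_injective _ hx]
      exact hp.trans_le (by exact_mod_cast hD)
    · simp only [Finset.mem_image, forall_exists_index, and_imp, forall_apply_eq_imp_iff₂]
      intro i hi
      simp [p, Polynomial.eval_finsetSum, h i hi]
  funext a
  have := congrArg (fun p => Polynomial.coeff p a.1) hp0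
  simpa [p, Polynomial.finsetSum_coeff, Polynomial.coeff_monomial, Fin.val_inj, sub_eq_zero]
    using this

/-- The values `U(x_i, x_j)`, at the pairs `(i, j)`, of the bivariate polynomial
`U(X, Y) = ∑ U (a, b) X ^ a Y ^ b` of degree below `d` in `X` and below `n` in `Y`. -/
def evalMatrix {F : Type*} [Field F] {n d : ℕ} (x : Fin n → F) (U : Fin d × Fin n → F) :
    Fin n × Fin n → F :=
  fun p => ∑ a, ∑ b, U (a, b) * x p.1 ^ a.1 * x p.2 ^ b.1

section EvalMatrix

variable {F : Type*} [Field F] {n d : ℕ} {x : Fin n → F} {U U' : Fin d × Fin n → F}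

theorem evalMatrix_add (x : Fin n → F) (U U' : Fin d × Fin n → F) :
    evalMatrix x (U + U') = evalMatrix x U + evalMatrix x U' := by
  funext p
  simp [evalMatrix, add_mul, Finset.sum_add_distrib]

theorem evalMatrix_row (x : Fin n → F) (U : Fin d × Fin n → F) (i j : Fin n) :
    evalMatrix x U (i, j) = ∑ b, (∑ a, U (a, b) * x i ^ a.1) * x j ^ b.1 := by
  simp only [evalMatrix, Finset.sum_mul]
  exact Finset.sum_comm

theorem evalMatrix_column (x : Fin n → F) (U : Fin d × Fin n → F) (i j : Fin n) :
    evalMatrix x U (i, j) = ∑ a, (∑ b, U (a, b) * x j ^ b.1) * x i ^ a.1 := by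
  simp only [evalMatrix, Finset.sum_mul]
  exact Finset.sum_congr rfl fun a _ => Finset.sum_congr rfl fun b _ => by ring

/-- The polynomial `U(X, x_j)`, of degree below `d`, is determined by `d` of its values. -/
theorem columnCoeff_eq_of_evalMatrix_eq (hx : Function.Injective x) {D : Finset (Fin n)}
    (hD : d ≤ D.card) (j : Fin n)
    (h : ∀ i ∈ D, evalMatrix x U (i, j) = evalMatrix x U' (i, j)) (a : Fin d) :
    ∑ b, U (a, b) * x j ^ b.1 = ∑ b, U' (a, b) * x j ^ b.1 := by
  refine congrFun (eq_of_sum_mul_pow_eq hx hD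
    (c := fun a => ∑ b, U (a, b) * x j ^ b.1) (c' := fun a => ∑ b, U' (a, b) * x j ^ b.1)
    (fun a ha => absurd ha (by omega)) ?_) a
  simpa only [evalMatrix_column] using h

theorem evalMatrix_column_eq (hx : Function.Injective x) {D : Finset (Fin n)}
    (hD : d ≤ D.card) (j : Fin n)
    (h : ∀ i ∈ D, evalMatrix x U (i, j) = evalMatrix x U' (i, j)) (i : Fin n) :
    evalMatrix x U (i, j) = evalMatrix x U' (i, j) := by
  simp only [evalMatrix_column, columnCoeff_eq_of_evalMatrix_eq hx hD j h]

/-- The exponents `(a, b)` with `a < s` or `b < s`. -/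
def firstHook (d n s : ℕ) : Finset (Fin d × Fin n) :=
  hook (firstNodes d s) Finset.univ (firstNodes n s)

theorem mem_firstHook {s : ℕ} {p : Fin d × Fin n} :
    p ∈ firstHook d n s ↔ p.1.1 < s ∨ p.2.1 < s := by
  simp [firstHook, mem_hook, firstNodes]

theorem firstHook_mono {l k : ℕ} (h : l ≤ k) : firstHook d n l ⊆ firstHook d n k := by
  intro p
  simp only [mem_firstHook]
  omega

theorem card_firstHook {s : ℕ} (hd : s ≤ d) (hn : s ≤ n) :
    (firstHook d n s).card = s * n + (d - s) * s := by
  simp [firstHook, card_hook, card_firstNodes, hd, hn]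

/-- A bivariate polynomial with prescribed coefficients outside `firstHook d n s` is determined by
the polynomials `U(x_i, Y)` and `U(X, x_i)` for `s` indices `i`. -/
theorem eq_of_evalMatrix_eq (hx : Function.Injective x) {s : ℕ} {E : Finset (Fin n)}
    (hE : s ≤ E.card) (D : Fin n → Finset (Fin n)) (hD : ∀ j ∈ E, d ≤ (D j).card)
    (hU : ∀ p ∉ firstHook d n s, U p = U' p)
    (hrow : ∀ i ∈ E, ∀ j, evalMatrix x U (i, j) = evalMatrix x U' (i, j))
    (hcol : ∀ j ∈ E, ∀ i ∈ D j, evalMatrix x U (i, j) = evalMatrix x U' (i, j)) : U = U' := by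
  -- For `b ≥ s` the coefficient of `Y ^ b` has degree below `s` in `X`, up to known terms, and its
  -- values at the `s` points of `E` are coefficients of the row polynomials `U(x_i, Y)`.
  have hright (a : Fin d) (b : Fin n) (hb : s ≤ b.1) : U (a, b) = U' (a, b) := by
    refine congrFun (eq_of_sum_mul_pow_eq hx hE (c := fun a => U (a, b))
      (c' := fun a => U' (a, b)) (fun a ha => hU _ ?_) fun i hi => ?_) a
    · rw [mem_firstHook]; simp only; omega
    · refine congrFun (eq_of_sum_mul_pow_eq hx (s := n) (D := Finset.univ) (by simp)
        (c := fun b => ∑ a, U (a, b) * x i ^ a.1) (c' := fun b => ∑ a, U' (a, b) * x i ^ a.1)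
        (fun b hb => absurd hb (by omega)) fun j _ => ?_) b
      simpa only [evalMatrix_row] using hrow i hi j
  -- What remains has degree below `s` in `Y`, so that the column polynomials `U(X, x_j)` suffice.
  funext ⟨a, b⟩
  exact congrFun (eq_of_sum_mul_pow_eq hx hE (c := fun b => U (a, b)) (c' := fun b => U' (a, b))
    (hright a) fun j hj => columnCoeff_eq_of_evalMatrix_eq hx (hD j hj) j (hcol j hj) a) b

end EvalMatrix

/-- The extension by zero of a function on the finite set `S`. -/
def extendZero {ι F : Type*} [Zero F] [DecidableEq ι] {S : Finset ι} (f : S → F) : ι → F :=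
  fun p => if h : p ∈ S then f ⟨p, h⟩ else 0

section ExtendZero

variable {ι F : Type*} [DecidableEq ι] {S : Finset ι}

theorem extendZero_coe [Zero F] (f : S → F) (p : S) : extendZero f p = f p := by
  simp [extendZero]

theorem extendZero_of_notMem [Zero F] (f : S → F) {p : ι} (hp : p ∉ S) : extendZero f p = 0 := by
  simp [extendZero, hp]

theorem extendZero_injective [Zero F] :
    Function.Injective (extendZero : (S → F) → ι → F) := fun f g h =>
  funext fun p => by rw [← extendZero_coe f, h, extendZero_coe]

theorem extendZero_add [AddZeroClass F] (f g : S → F) :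
    extendZero (f + g) = extendZero f + extendZero g := by
  funext p
  by_cases hp : p ∈ S <;> simp [extendZero, hp]

end ExtendZero

/-- The rows and columns `E` of any `evalMatrix` are those of a polynomial supported on
`firstHook d n |E|`: by `eq_of_evalMatrix_eq`, taking such polynomials to their values on
`hook E D E` is injective, and `firstHook d n |E|` and `hook E D E` have the same size. -/
theorem exists_hook_eq_evalMatrix {F : Type*} [Field F] [Finite F] {n d : ℕ} {x : Fin n → F}
    (hx : Function.Injective x) {E D : Finset (Fin n)} (hED : E ⊆ D) (hD : D.card = d)
    (U : Fin d × Fin n → F) :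
    ∃ r : firstHook d n E.card → F, ∀ i ∈ E, ∀ j,
      evalMatrix x (extendZero r) (i, j) = evalMatrix x U (i, j) ∧
      evalMatrix x (extendZero r) (j, i) = evalMatrix x U (j, i) := by
  classical
  have := Fintype.ofFinite F
  have hEd : E.card ≤ d := hD ▸ Finset.card_le_card hED
  have hEn : E.card ≤ n := by simpa using E.card_le_univ
  let Θ : (firstHook d n E.card → F) → hook E D E → F :=
    fun r p => evalMatrix x (extendZero r) p
  have hinj : Function.Injective Θ := by
    intro r r' h
    have h' (p) (hp : p ∈ hook E D E) := congrFun h ⟨p, hp⟩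
    refine extendZero_injective (eq_of_evalMatrix_eq hx le_rfl (fun _ => D) (fun _ _ => hD.ge)
      (fun p hp => ?_) (fun i hi j => h' _ (mem_hook.2 (Or.inl hi)))
      fun j hj i hi => h' _ (mem_hook.2 (Or.inr ⟨hi, hj⟩)))
    rw [extendZero_of_notMem _ hp, extendZero_of_notMem _ hp]
  have hcard : Fintype.card (firstHook d n E.card → F) = Fintype.card (hook E D E → F) := by
    rw [Fintype.card_fun, Fintype.card_fun, Fintype.card_coe, Fintype.card_coe,
      card_firstHook hEd hEn, card_hook hED, hD, Fintype.card_fin]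
  obtain ⟨r, hr⟩ := ((Fintype.bijective_iff_injective_and_card Θ).2 ⟨hinj, hcard⟩).2
    fun p => evalMatrix x U p
  have hr' (p) (hp : p ∈ hook E D E) := congrFun hr ⟨p, hp⟩
  exact ⟨r, fun i hi j => ⟨hr' _ (mem_hook.2 (Or.inl hi)), evalMatrix_column_eq hx hD.ge i
    (fun a ha => hr' _ (mem_hook.2 (Or.inr ⟨ha, hi⟩))) j⟩⟩

/-! ### The storage code -/

section Code

variable {F : Type*} [Field F] {n k d t α M : ℕ}

/-- The bookkeeping behind the code: a numbering of the coefficients of a file, for each node `i` a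
set `samples i` of `d` nodes, and a numbering of the values stored by node `i`.  These are the
`U(x_i, x_j)` for all `j` and the `U(x_j, x_i)` for `j ∈ samples i`, where the value for `j = i` is
common to both families, so that there are `n + d - 1 = α` of them. -/
structure StorageLayout (n k d M α : ℕ) where
  coeffs : firstHook d n k ≃ Fin M
  samples : Fin n → Finset (Fin n)
  mem_samples : ∀ i, i ∈ samples i
  card_samples : ∀ i, (samples i).card = d
  positions : ∀ i, Fin α ≃ hook {i} (samples i) {i}

namespace StorageLayout

theorem nonempty (hk : 1 ≤ k) (hkd : k ≤ d) (hn : n = d + t) (hα : α + 1 = 2 * d + t)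
    (hM : (M : ℤ) = k * (2 * d - k + t)) : Nonempty (StorageLayout n k d M α) := by
  have hS (i : Fin n) : ∃ S : Finset (Fin n), i ∈ S ∧ S.card = d := by
    obtain ⟨S, hiS, -, hS⟩ := Finset.exists_subsuperset_card_eq (Finset.subset_univ {i})
      (n := d) (by rw [Finset.card_singleton]; omega)
      (by rw [Finset.card_univ, Fintype.card_fin]; omega)
    exact ⟨S, by simpa using hiS, hS⟩
  choose S hiS hS using hS
  refine ⟨⟨Fintype.equivFinOfCardEq ?_, S, hiS, hS,
    fun i => (Fintype.equivFinOfCardEq ?_).symm⟩⟩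
  · rw [Fintype.card_coe, card_firstHook hkd (by omega)]
    zify
    rw [hM, hn, Nat.cast_sub hkd]
    push_cast
    ring
  · rw [Fintype.card_coe, card_hook (by simpa using hiS i), hS]
    simp only [Finset.card_singleton, Fintype.card_fin]
    omega

variable (L : StorageLayout n k d M α) {x : Fin n → F}

/-- What node `i` stores of the bivariate polynomial `U`. -/
def content (x : Fin n → F) (U : Fin d × Fin n → F) (i : Fin n) : Fin α → F :=
  fun a => evalMatrix x U (L.positions i a)

/-- The content of node `i` amounts to the two polynomials `U(x_i, Y)` and `U(X, x_i)`. -/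
theorem content_eq_iff (hx : Function.Injective x) {U U' : Fin d × Fin n → F} {i : Fin n} :
    L.content x U i = L.content x U' i ↔ ∀ j,
      evalMatrix x U (i, j) = evalMatrix x U' (i, j) ∧
      evalMatrix x U (j, i) = evalMatrix x U' (j, i) := by
  constructor
  · intro h
    have h' (p) (hp : p ∈ hook {i} (L.samples i) {i}) :
        evalMatrix x U p = evalMatrix x U' p := by
      have := congrFun h ((L.positions i).symm ⟨p, hp⟩)
      simpa [content] using this
    exact fun j => ⟨h' _ (mem_hook.2 (Or.inl (by simp))),
      evalMatrix_column_eq hx (L.card_samples i).ge i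
        (fun a ha => h' _ (mem_hook.2 (Or.inr ⟨ha, by simp⟩))) j⟩
  · intro h
    funext a
    obtain ⟨⟨⟨p, q⟩, hpq⟩, hp⟩ : ∃ p, p = L.positions i a := ⟨_, rfl⟩
    simp only [content, ← hp]
    rcases mem_hook.1 hpq with h' | ⟨-, h'⟩
    · obtain rfl := Finset.mem_singleton.1 h'
      exact (h q).1
    · obtain rfl := Finset.mem_singleton.1 h'
      exact (h p).2

/-- The coefficients of the bivariate polynomial that represents the file `f`. -/
def fileMatrix (f : Fin M → F) : Fin d × Fin n → F :=
  extendZero (f ∘ L.coeffs)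

theorem fileMatrix_injective : Function.Injective (L.fileMatrix (F := F)) := fun _ _ h =>
  L.coeffs.surjective.injective_comp_right (extendZero_injective h)

theorem fileMatrix_comp_symm {U : Fin d × Fin n → F} (hU : ∀ p ∉ firstHook d n k, U p = 0) :
    L.fileMatrix (fun m => U (L.coeffs.symm m)) = U := by
  funext p
  by_cases hp : p ∈ firstHook d n k
  · simp [fileMatrix, extendZero, hp]
  · rw [hU p hp, fileMatrix, extendZero_of_notMem _ hp]

/-- The bivariate polynomial code.  Helper `j` sends `U(x_j, x_i)` and `U(x_i, x_j)` to newcomer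
`i`, and newcomer `i'` sends `U(x_i, x_{i'})` to newcomer `i`.  The maps `down`, `coop` and `regen` are
obtained by showing that what they have to output is determined by their input. -/
noncomputable def code (hx : Function.Injective x) (hn : n = d + t) :
    CoopRegeneratingCode F n k d t M α 2 1 where
  encode f i := L.content x (L.fileMatrix f) i
  reconstruct K hK := by
    suffices h : Function.Injective fun f (j : K) => L.content x (L.fileMatrix f) j from
      ⟨Function.invFun _, Function.leftInverse_invFun h⟩
    intro f f' h
    have h' (j) (hj : j ∈ K) := (L.content_eq_iff hx).1 (congrFun h ⟨j, hj⟩)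
    exact L.fileMatrix_injective (eq_of_evalMatrix_eq hx hK.ge L.samples
      (fun j _ => (L.card_samples j).ge)
      (fun p hp => by simp only [fileMatrix, extendZero_of_notMem _ hp])
      (fun i hi j => (h' i hi j).1) fun j hj i _ => (h' j hj i).2)
  repair T hT H hH := by
    have hdown (i : T) (j : H i) : ∃ φ : (Fin α → F) → Fin 2 → F,
        (fun f => ![evalMatrix x (L.fileMatrix f) (j, i), evalMatrix x (L.fileMatrix f) (i, j)]) =
          φ ∘ fun f => L.content x (L.fileMatrix f) j := by
      refine (Function.factorsThrough_iff _).1 fun f f' h => ?_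
      have h' := (L.content_eq_iff hx).1 h i
      simp only [h'.1, h'.2]
    choose down hdown using hdown
    have hdown' (i : T) (j : H i) (f : Fin M → F) : down i j (L.content x (L.fileMatrix f) j) =
        ![evalMatrix x (L.fileMatrix f) (j, i), evalMatrix x (L.fileMatrix f) (i, j)] :=
      (congrFun (hdown i j) f).symm
    have hcol (i : T) {f f' : Fin M → F}
        (h : (fun j => down i j (L.content x (L.fileMatrix f) j)) =
          fun j => down i j (L.content x (L.fileMatrix f') j)) (i' : Fin n) :
        evalMatrix x (L.fileMatrix f) (i', i) = evalMatrix x (L.fileMatrix f') (i', i) := by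
      refine evalMatrix_column_eq hx (hH i).1.ge i (fun j hj => ?_) i'
      have := congrFun (congrFun h ⟨j, hj⟩) 0
      simpa [hdown'] using this
    have hcoop (i' i : T) : ∃ φ : (H i' → Fin 2 → F) → Fin 1 → F,
        (fun f _ => evalMatrix x (L.fileMatrix f) (i, i')) =
          φ ∘ fun f j => down i' j (L.content x (L.fileMatrix f) j) :=
      (Function.factorsThrough_iff _).1 fun f f' h => funext fun _ => hcol i' h i
    choose coop hcoop using hcoop
    have hregen (i : T) :
        ∃ φ : (H i → Fin 2 → F) × ({i' : T // i' ≠ i} → Fin 1 → F) → Fin α → F,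
        (fun f => L.content x (L.fileMatrix f) i) = φ ∘ fun f =>
          (fun j => down i j (L.content x (L.fileMatrix f) j),
            fun i' => coop i' i fun j => down i' j (L.content x (L.fileMatrix f) j)) := by
      refine (Function.factorsThrough_iff _).1 fun f f' h => ?_
      have h1 := congrArg Prod.fst h
      have h2 := congrArg Prod.snd h
      simp only at h1 h2
      refine (L.content_eq_iff hx).2 fun j => ⟨?_, hcol i h1 j⟩
      by_cases hj : j ∈ T
      · by_cases hji : (⟨j, hj⟩ : T) = i
        · obtain rfl : j = i := congrArg Subtype.val hji
          exact hcol i h1 i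
        · have := congrFun (congrFun h2 ⟨⟨j, hj⟩, hji⟩) 0
          have hc (g) := congrFun (congrFun (hcoop ⟨j, hj⟩ i) g) 0
          simp only [Function.comp_def] at hc
          rw [hc, hc]
          exact this
      · have hjH : j ∈ H i := by
          have : H i = Tᶜ := Finset.eq_of_subset_of_card_le
            (Finset.subset_compl_iff_disjoint_right.2 (hH i).2)
            (by rw [Finset.card_compl, Fintype.card_fin, (hH i).1]; omega)
          rw [this]; simpa using hj
        have := congrFun (congrFun h1 ⟨j, hjH⟩) 1
        simpa [hdown'] using this
    choose regen hregen using hregen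
    exact ⟨down, coop, fun i a b => regen i (a, b), fun f i => (congrFun (hregen i) f).symm⟩

/-! ### The secrecy precoding -/

variable {l Ms : ℕ} (e : (firstHook d n k \ firstHook d n l : Finset _) ≃ Fin Ms)

/-- The file whose coefficients on `firstHook d n l` are the random symbols `r` and whose other
coefficients are the symbols of the secret `u`. -/
def maskedFile (u : Fin Ms → F) (r : firstHook d n l → F) : Fin M → F :=
  fun m => (extendZero (u ∘ e) + extendZero r : Fin d × Fin n → F) (L.coeffs.symm m)

theorem fileMatrix_maskedFile (hl : l ≤ k) (u : Fin Ms → F) (r : firstHook d n l → F) :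
    L.fileMatrix (L.maskedFile e u r) = extendZero (u ∘ e) + extendZero r := by
  refine L.fileMatrix_comp_symm fun p hp => ?_
  rw [Pi.add_apply, extendZero_of_notMem _ (fun h => hp (Finset.mem_sdiff.1 h).1),
    extendZero_of_notMem _ (fun h => hp (firstHook_mono hl h)), add_zero]

/-- Mask the secret by uniformly random coefficients on `firstHook d n l`. -/
noncomputable def precoding [Fintype F] : SecrecyPrecoding F Ms M where
  enc u := (PMF.uniformOfFintype (firstHook d n l → F)).map (L.maskedFile e u)
  dec f := fun c => f (L.coeffs ⟨(e.symm c).1, (Finset.mem_sdiff.1 (e.symm c).2).1⟩)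
  dec_enc u f hf := by
    obtain ⟨r, -, rfl⟩ := (PMF.mem_support_map_iff ..).1 hf
    funext c
    simp only [maskedFile, Equiv.symm_apply_apply, Pi.add_apply]
    rw [extendZero_of_notMem r (Finset.mem_sdiff.1 (e.symm c).2).2, extendZero_coe]
    simp

theorem mutualInfo_precoding [Fintype F] (hx : Function.Injective x) (hn : n = d + t)
    (hl : l ≤ k) (hkd : k ≤ d) {E : Finset (Fin n)} (hE : E.card = l) :
    mutualInfo ((L.precoding e).jointLaw fun f (i : E) => (L.code hx hn).encode f i) = 0 := by
  subst hE
  obtain ⟨D, hED, -, hD⟩ := Finset.exists_subsuperset_card_eq (Finset.subset_univ E)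
    (n := d) (by omega) (by rw [Finset.card_univ, Fintype.card_fin]; omega)
  refine mutualInfo_jointLaw_eq_zero _ _ ((PMF.uniformOfFintype _).map
    fun (r : firstHook d n E.card → F) (i : E) => L.content x (extendZero r) i) fun u => ?_
  -- The nodes `E` see the secret part as the polynomial `s` supported on the random coefficients,
  -- so the secret only translates the uniformly distributed randomness by `s`.
  obtain ⟨s, hs⟩ := exists_hook_eq_evalMatrix hx hED hD (extendZero (u ∘ e))
  conv_rhs => rw [← PMF.map_equiv_uniformOfFintype (Equiv.addLeft s)]
  simp only [precoding, code, PMF.map_comp]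
  congr 1
  funext r i
  simp only [Function.comp_apply, L.fileMatrix_maskedFile e hl, Equiv.coe_addLeft, extendZero_add]
  refine (L.content_eq_iff hx).2 fun j => ?_
  simp only [evalMatrix_add, Pi.add_apply, hs i i.2 j, and_self]

end StorageLayout

end Code

theorem achievesSecureFileSize {F : Type*} [Field F] [Fintype F] {n k d t l M α C : ℕ}
    (hk : 1 ≤ k) (hkd : k ≤ d) (hl : l ≤ k) (hn : n = d + t) (hα : α + 1 = 2 * d + t)
    (hM : (M : ℤ) = k * (2 * d - k + t))
    (hC : (C : ℤ) = k * (2 * d - k + t) - l * (2 * d - l + t))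
    (hF : n ≤ Fintype.card F) : AchievesSecureFileSize F n k d t M α 2 1 l C := by
  obtain ⟨x⟩ : Nonempty (Fin n ↪ F) :=
    Function.Embedding.nonempty_of_card_le (by rwa [Fintype.card_fin])
  obtain ⟨L⟩ := StorageLayout.nonempty hk hkd hn hα hM
  have hcard : Fintype.card (firstHook d n k \ firstHook d n l : Finset _) = C := by
    have hkn : k ≤ n := by omega
    have hle := Finset.card_le_card (firstHook_mono (d := d) (n := n) hl)
    rw [Fintype.card_coe, Finset.card_sdiff_of_subset (firstHook_mono hl)]
    rw [card_firstHook hkd hkn, card_firstHook (hl.trans hkd) (hl.trans hkn)] at *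
    zify [hle]
    rw [hC, hn, Nat.cast_sub hkd, Nat.cast_sub (hl.trans hkd)]
    push_cast
    ring
  let e := Fintype.equivFinOfCardEq hcard
  exact ⟨L.code x.injective hn, L.precoding e, fun E hE =>
    L.mutualInfo_precoding e x.injective hn hl hkd hE⟩

/-! ### The secrecy capacity -/

theorem mainTheorem2 (n k d t ℓ₁ M α β β' : ℕ)
    (hk : 1 ≤ k) (hkd : k ≤ d) (ht : 1 ≤ t) (hℓ : ℓ₁ ≤ k) (hn : n = d + t)
    (hM : (M : ℤ) = k * (2 * d - k + t)) (hpoint : IsMBCRPoint k d t M α β β') :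
    ∃ C : ℕ, (C : ℤ) = k * (2 * d - k + t) - ℓ₁ * (2 * d - ℓ₁ + t) ∧
      (∀ (F : Type u) [Field F] [Fintype F] (Ms : ℕ),
        AchievesSecureFileSize F n k d t M α β β' ℓ₁ Ms → Ms ≤ C) ∧
      ∃ q₀ : ℕ, ∀ (F : Type u) [Field F] [Fintype F], q₀ ≤ Fintype.card F →
        IsGreatest {Ms : ℕ | AchievesSecureFileSize F n k d t M α β β' ℓ₁ Ms} C := by
  obtain ⟨hα, rfl, rfl⟩ := hpoint.eq_of_file_size hk hkd ht hM
  have hC : (((k - ℓ₁) * (2 * d + t - k - ℓ₁) : ℕ) : ℤ) =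
      k * (2 * d - k + t) - ℓ₁ * (2 * d - ℓ₁ + t) := by
    rw [Nat.cast_mul, Nat.cast_sub hℓ, Nat.cast_sub (by omega), Nat.cast_sub (by omega)]
    push_cast
    ring
  exact ⟨_, hC, fun F _ _ Ms h => h.le hkd ht hℓ hn hC, n, fun F _ _ hF =>
    ⟨achievesSecureFileSize hk hkd hℓ hn hα hM hC hF, fun Ms h => h.le hkd ht hℓ hn hC⟩⟩
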